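/- Let $N,M\ge 1$ be integers and let $\mathrm{BS}(N,M)=\langle a,b\mid a^Nb=ba^M\rangle$. Words are finite sequences of letters from $\{a,a^{-1},b,b^{-1}\}$, not necessarily freely reduced. Let $\mathcal H$ be the set of words that generate an element of the subgroup $\langle a\rangle$ (the horocyclic subgroup). Let $\mathcal L$ be the set of words in $\mathcal H$ that cannot be written as $uv$ with $u$ generating an element of the form $ba^j$, $j\in\mathbb Z$, and let $\mathcal K$ be the set of words in $\mathcal H$ that cannot be written as $uv$ with $u$ generating an element of the form $b^{-1}a^j$, $j\in\mathbb Z$. For $\mathcal S\in\{\mathcal H,\mathcal L,\mathcal K\}$ let $s_{n,k}$ be the number of words of length $n$ in $\mathcal S$ that generate $a^k$; for each $n$ only finitely many $s_{n,k}$ are non-zero. Let $G$, $L$, $K$ be the generating functions $\sum_{n\ge 0}z^n\sum_{k\in\mathbb Z}s_{n,k}q^k\in\mathbb Z[q,q^{-1}][[z]]$ of $\mathcal H$, $\mathcal L$, $\mathcal K$ respectively. For integers $d,e\ge1$ define $$\Phi_{d,e}\circ\sum_n z^n\sum_k c_{n,k}q^k=\sum_n z^n\sum_{j}c_{n,dj}\,q^{ej},$$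 and write $\bar q=q^{-1}$. Then the following identities hold in $\mathbb Z[q,q^{-1}][[z]]$: $$L=1+z(q+\bar q)L+z^2L\cdot\left[\Phi_{N,M}\circ L+\Phi_{M,N}\circ K\right]-z^2\left[\Phi_{M,N}\circ K\right]\cdot\left[\Phi_{N,N}\circ L\right],$$ $$K=1+z(q+\bar q)K+z^2K\cdot\left[\Phi_{M,N}\circ K+\Phi_{N,M}\circ L\right]-z^2\left[\Phi_{N,M}\circ L\right]\cdot\left[\Phi_{M,M}\circ K\right],$$ $$G=1+z(q+\bar q)G+z^2G\cdot\left[\Phi_{N,M}\circ L+\Phi_{M,N}\circ K\right].$$ -/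

import Mathlib

open scoped LaurentPolynomial

namespace BaumslagSolitar

/-- The two generators of a Baumslag-Solitar group. -/
inductive Gen
  | a
  | b

/-- The Baumslag-Solitar group `BS(N, M) = ⟨a, b | a^N b a^(-M) b⁻¹⟩`. -/
abbrev BS (N M : ℕ) : Type :=
  PresentedGroup
    ({FreeGroup.of Gen.a ^ N * FreeGroup.of Gen.b * (FreeGroup.of Gen.a ^ M)⁻¹ *
      (FreeGroup.of Gen.b)⁻¹} : Set (FreeGroup Gen))

/-- The generator `a` of `BS(N, M)`. -/
def genA (N M : ℕ) : BS N M := PresentedGroup.of Gen.a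

/-- The generator `b` of `BS(N, M)`. -/
def genB (N M : ℕ) : BS N M := PresentedGroup.of Gen.b

/-- The alphabet `{a, a⁻¹, b, b⁻¹}`. -/
inductive Letter
  | a
  | aInv
  | b
  | bInv

instance : Finite Letter :=
  Finite.of_surjective
    (fun i : Fin 4 => match i with
      | 0 => Letter.a
      | 1 => Letter.aInv
      | 2 => Letter.b
      | 3 => Letter.bInv)
    (by
      rintro (_ | _ | _ | _)
      · exact ⟨0, rfl⟩
      · exact ⟨1, rfl⟩
      · exact ⟨2, rfl⟩
      · exact ⟨3, rfl⟩)

/-- Words over `{a, a⁻¹, b, b⁻¹}`, not required to be freely reduced. -/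
abbrev Word : Type := List Letter

/-- The group element of a letter. -/
def Letter.toBS (N M : ℕ) : Letter → BS N M
  | Letter.a => genA N M
  | Letter.aInv => (genA N M)⁻¹
  | Letter.b => genB N M
  | Letter.bInv => (genB N M)⁻¹

/-- The group element that a word generates. -/
def eval (N M : ℕ) (w : Word) : BS N M := (w.map (Letter.toBS N M)).prod

/-- The words that generate an element of the horocyclic subgroup `⟨a⟩`. -/
def wordsH (N M : ℕ) : Set Word :=
  {w | eval N M w ∈ Subgroup.zpowers (genA N M)}

/-- The words of `wordsH` no prefix of which generates an element `b a^j`. -/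
def wordsL (N M : ℕ) : Set Word :=
  {w | w ∈ wordsH N M ∧
    ¬ ∃ u v : Word, w = u ++ v ∧ ∃ j : ℤ, eval N M u = genB N M * genA N M ^ j}

/-- The words of `wordsH` no prefix of which generates an element `b⁻¹ a^j`. -/
def wordsK (N M : ℕ) : Set Word :=
  {w | w ∈ wordsH N M ∧
    ¬ ∃ u v : Word, w = u ++ v ∧ ∃ j : ℤ, eval N M u = (genB N M)⁻¹ * genA N M ^ j}

/-- The number of words of length `n` in `S` that generate `a^k`. -/
noncomputable def count (N M : ℕ) (S : Set Word) (n : ℕ) (k : ℤ) : ℕ :=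
  Set.ncard {w : Word | w ∈ S ∧ w.length = n ∧ eval N M w = genA N M ^ k}

/-- The generator `a` has infinite order, by the action on `ℚ` with `a x = x + 1` and
`b x = (N / M) x`. -/
theorem genA_zpow_injective (N M : ℕ) [NeZero N] [NeZero M] :
    Function.Injective fun k : ℤ => genA N M ^ k := by
  have hN : (N : ℚ) ≠ 0 := Nat.cast_ne_zero.2 (NeZero.ne N)
  have hM : (M : ℚ) ≠ 0 := Nat.cast_ne_zero.2 (NeZero.ne M)
  let f : Gen → Equiv.Perm ℚ := fun g => match g with
    | Gen.a => Equiv.addRight (1 : ℚ)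
    | Gen.b => Equiv.mulRight₀ ((N : ℚ) / M) (div_ne_zero hN hM)
  have hpow : ∀ (n : ℕ) (x : ℚ), ((Equiv.addRight (1 : ℚ)) ^ n) x = x + n := by
    intro n
    induction n with
    | zero => simp
    | succ n ih =>
      intro x
      rw [pow_succ, Equiv.Perm.mul_apply, ih]
      simp only [Equiv.coe_addRight]
      push_cast
      ring
  have hzpow : ∀ (k : ℤ), ((Equiv.addRight (1 : ℚ)) ^ k) 0 = k := by
    intro k
    obtain ⟨n, rfl | rfl⟩ := k.eq_nat_or_neg
    · simp [zpow_natCast]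
    · rw [zpow_neg, zpow_natCast, Equiv.Perm.inv_def, Equiv.symm_apply_eq, hpow]
      simp
  have hrel : ∀ r ∈ ({FreeGroup.of Gen.a ^ N * FreeGroup.of Gen.b * (FreeGroup.of Gen.a ^ M)⁻¹ *
      (FreeGroup.of Gen.b)⁻¹} : Set (FreeGroup Gen)), FreeGroup.lift f r = 1 := by
    intro r hr
    rw [Set.mem_singleton_iff.1 hr, map_mul, map_inv, mul_inv_eq_one, map_mul, map_inv,
      mul_inv_eq_iff_eq_mul]
    ext x
    simp only [map_mul, map_pow, FreeGroup.lift_apply_of, f, Equiv.Perm.mul_apply, hpow]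
    change x * ((N : ℚ) / M) + N = (x + M) * ((N : ℚ) / M)
    field_simp
  intro k l hkl
  have h := congrArg (fun g => PresentedGroup.toGroup hrel g 0) hkl
  simp only [genA, map_zpow, PresentedGroup.toGroup.of, f, hzpow] at h
  exact_mod_cast h

/-- For each length only finitely many exponents occur. -/
theorem finite_support_count (N M : ℕ) [NeZero N] [NeZero M] (S : Set Word) (n : ℕ) :
    (Function.support fun k : ℤ => (count N M S n k : ℤ)).Finite := by
  have hfin : ((eval N M) '' {w : Word | w.length = n}).Finite :=
    (List.finite_length_eq Letter n).image _
  refine (hfin.preimage (genA_zpow_injective N M).injOn).subset ?_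
  intro k hk
  have hk' : count N M S n k ≠ 0 := by simpa using hk
  obtain ⟨w, -, hw, he⟩ := Set.nonempty_of_ncard_ne_zero hk'
  exact ⟨w, hw, he⟩

/-- The generating function `∑ c_{n,k} z^n q^k` of a set of words, where `c_{n,k}` is the
number of its words of length `n` that generate `a^k`. It is a power series in `z` over the
Laurent polynomials in `q` (in Mathlib's notation, `q ^ k` is `T k`). -/
noncomputable def genFun (N M : ℕ) [NeZero N] [NeZero M] (S : Set Word) :
    PowerSeries ℤ[T;T⁻¹] :=
  PowerSeries.mk fun n =>
    AddMonoidAlgebra.ofCoeff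
      (Finsupp.ofSupportFinite (fun k : ℤ => (count N M S n k : ℤ))
        (finite_support_count N M S n))

/-- The generating function `G(z; q)`. -/
noncomputable def G (N M : ℕ) [NeZero N] [NeZero M] : PowerSeries ℤ[T;T⁻¹] :=
  genFun N M (wordsH N M)

/-- The generating function `L(z; q)`. -/
noncomputable def L (N M : ℕ) [NeZero N] [NeZero M] : PowerSeries ℤ[T;T⁻¹] :=
  genFun N M (wordsL N M)

/-- The generating function `K(z; q)`. -/
noncomputable def K (N M : ℕ) [NeZero N] [NeZero M] : PowerSeries ℤ[T;T⁻¹] :=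
  genFun N M (wordsK N M)

/-- The operator `∑ z^n ∑ c_{n,k} q^k ↦ ∑ z^n ∑ c_{n,dj} q^(ej)`, for `d` positive. -/
noncomputable def Phi (d e : ℕ) (F : PowerSeries ℤ[T;T⁻¹]) : PowerSeries ℤ[T;T⁻¹] :=
  PowerSeries.mk fun n =>
    (PowerSeries.coeff n F).coeff.sum fun k c =>
      if (d : ℤ) ∣ k then AddMonoidAlgebra.single ((e : ℤ) * (k / d)) c else 0

/-- The variable `z`. -/
noncomputable def z : PowerSeries ℤ[T;T⁻¹] := PowerSeries.X

/-- The power `q ^ k` of the variable `q`. -/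
noncomputable def qPow (k : ℤ) : PowerSeries ℤ[T;T⁻¹] :=
  PowerSeries.C (LaurentPolynomial.T k)

end BaumslagSolitar

open BaumslagSolitar

/-!
The words are read as paths in the coset graph of `⟨a⟩`: the letters `a` and `a⁻¹` keep the
current coset `g⟨a⟩`, and a stable letter `b` or `b⁻¹` moves to an adjacent coset. The graph is a
tree, and the equations come from cutting a word of `wordsH` at its last visit to `⟨a⟩`. Unless it
is empty or ends in `a` or `a⁻¹`, such a word is uniquely `u x v x⁻¹`, where `x` is a stable
letter, `u` generates an element of `⟨a⟩`, and `v` is an excursion: the path of `x v` does not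
return to `⟨a⟩`. So `v` is counted by `K` for `x = b` and by `L` for `x = b⁻¹`, and as `x v x⁻¹`
has to lie in `⟨a⟩`, its exponent is a multiple of `M` or `N`; conjugation by `x` turns it into
the same multiple of `N` or `M`. This is the operator `Phi`. If the word is to avoid the coset
`b⟨a⟩`, then `u` has to avoid it, and for `x = b` the excursion must not go to `b⟨a⟩` itself,
which excludes the `u` whose exponent is divisible by `N`; they account for the subtracted term.
The case of `b⁻¹⟨a⟩` is symmetric, and both are treated at once with a stable letter indexed by a
Boolean.

Only a little of the tree property is needed, namely that the cosets adjacent to `⟨a⟩` are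
separated from each other by `⟨a⟩`. It does not require normal forms. By `exists_cocycle`,
increments along the `b`-edges that are compatible with the relation are the increments of a
function on the group. Placing a unit increment on the edges at `⟨a⟩`, labelled by the other end
of the edge, gives a function that is constant on every path outside `⟨a⟩` and remembers the
neighbour at which the path started (`exists_branch`). The increments on one single edge give the
divisibility conditions (`stable_inv_mul_zpow_mul_mem_iff`).
-/

namespace BaumslagSolitar

open LaurentPolynomial

/-! ### The group: relation, exponents and cocycles -/

section Group

variable (N M : ℕ)

/-- The horocyclic subgroup `⟨a⟩`. -/
abbrev horo : Subgroup (BS N M) := Subgroup.zpowers (genA N M)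

/-- The generator `b` for `true` and its inverse for `false`. -/
def stable : Bool → BS N M
  | true => genB N M
  | false => (genB N M)⁻¹

/-- The letter `b` for `true` and the letter `b⁻¹` for `false`. -/
def stableLetter : Bool → Letter
  | true => Letter.b
  | false => Letter.bInv

/-- The index in `⟨a⟩` of the stabilizer of the coset `b⟨a⟩` (for `true`) or `b⁻¹⟨a⟩` (for
`false`). -/
def period : Bool → ℕ
  | true => N
  | false => M

variable {N M}

theorem genA_pow_mul_genB : genA N M ^ N * genB N M = genB N M * genA N M ^ M := by
  have h : PresentedGroup.mk ({FreeGroup.of Gen.a ^ N * FreeGroup.of Gen.b *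
      (FreeGroup.of Gen.a ^ M)⁻¹ * (FreeGroup.of Gen.b)⁻¹} : Set (FreeGroup Gen))
      (FreeGroup.of Gen.a ^ N * FreeGroup.of Gen.b *
      (FreeGroup.of Gen.a ^ M)⁻¹ * (FreeGroup.of Gen.b)⁻¹) = 1 :=
    (PresentedGroup.mk_eq_one_iff).2 (Subgroup.subset_normalClosure (Set.mem_singleton _))
  rw [map_mul, map_inv, mul_inv_eq_one, map_mul, map_inv, mul_inv_eq_iff_eq_mul, map_mul,
    map_pow, map_pow] at h
  exact h

theorem stable_not (x : Bool) : stable N M (!x) = (stable N M x)⁻¹ := by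
  cases x <;> simp [stable]

theorem genA_zpow_mul_stable (x : Bool) (k : ℤ) :
    genA N M ^ (period N M x * k) * stable N M x =
      stable N M x * genA N M ^ (period N M (!x) * k) := by
  have hb : genA N M ^ ((N : ℤ) * k) * genB N M = genB N M * genA N M ^ ((M : ℤ) * k) := by
    have h : SemiconjBy (genB N M) (genA N M ^ M) (genA N M ^ N) := genA_pow_mul_genB.symm
    simp only [zpow_mul, zpow_natCast]
    exact (h.zpow_right k).eq.symm
  cases x
  · change genA N M ^ ((M : ℤ) * k) * (genB N M)⁻¹ = (genB N M)⁻¹ * genA N M ^ ((N : ℤ) * k)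
    rw [mul_inv_eq_iff_eq_mul, mul_assoc (genB N M)⁻¹, hb, inv_mul_cancel_left]
  · exact hb

/-- The exponent sum of `b`, as a homomorphism. -/
theorem exists_height (N M : ℕ) : ∃ f : BS N M →* Multiplicative ℤ,
    f (genA N M) = 1 ∧ f (genB N M) = Multiplicative.ofAdd 1 := by
  let f : Gen → Multiplicative ℤ := fun g => match g with
    | Gen.a => 1
    | Gen.b => Multiplicative.ofAdd 1
  have hrel : ∀ r ∈ ({FreeGroup.of Gen.a ^ N * FreeGroup.of Gen.b * (FreeGroup.of Gen.a ^ M)⁻¹ *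
      (FreeGroup.of Gen.b)⁻¹} : Set (FreeGroup Gen)), FreeGroup.lift f r = 1 := by
    intro r hr
    rw [Set.mem_singleton_iff.1 hr]
    simp [f]
  exact ⟨PresentedGroup.toGroup hrel, PresentedGroup.toGroup.of hrel,
    PresentedGroup.toGroup.of hrel⟩

theorem stable_mul_mul_stable_notMem (x : Bool) {g : BS N M} (hg : g ∈ horo N M) :
    stable N M x * g * stable N M x ∉ horo N M := by
  obtain ⟨f, hA, hB⟩ := exists_height N M
  have hZ : ∀ g ∈ horo N M, f g = 1 := by
    rintro _ ⟨k, rfl⟩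
    simp [hA]
  intro h
  have h1 := hZ _ h
  rw [map_mul, map_mul, hZ _ hg] at h1
  have h2 := congrArg Multiplicative.toAdd h1
  cases x <;> simp [stable, hB] at h2

theorem stable_notMem (x : Bool) : stable N M x ∉ horo N M := fun h =>
  stable_mul_mul_stable_notMem x (one_mem _) (by simpa using mul_mem h h)

/-- A function that is invariant under `g ↦ g a^N` prescribes the increments along the `b`-edges of
a function on the group that is constant along the `a`-edges: going around the relator
`a^N b a^(-M) b⁻¹` the increments cancel. The function is read off from an action of the group on
`BS N M × A`, in which `g` acts on the first component as right multiplication by `g⁻¹`. -/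
theorem exists_cocycle {A : Type*} [AddCommGroup A] (φ : BS N M → A)
    (hφ : ∀ g, φ (g * genA N M ^ N) = φ g) :
    ∃ c : BS N M → A, c 1 = 0 ∧ (∀ g, c (g * genA N M) = c g) ∧
      ∀ g, c (g * genB N M) = c g + φ g := by
  let σa : Equiv.Perm (BS N M × A) :=
    { toFun := fun p => (p.1 * (genA N M)⁻¹, p.2)
      invFun := fun p => (p.1 * genA N M, p.2)
      left_inv := fun p => by simp
      right_inv := fun p => by simp }
  let σb : Equiv.Perm (BS N M × A) :=
    { toFun := fun p => (p.1 * (genB N M)⁻¹, p.2 - φ (p.1 * (genB N M)⁻¹))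
      invFun := fun p => (p.1 * genB N M, p.2 + φ p.1)
      left_inv := fun p => by simp
      right_inv := fun p => by simp }
  let f : Gen → Equiv.Perm (BS N M × A) := fun g => match g with
    | Gen.a => σa
    | Gen.b => σb
  have hpow : ∀ (n : ℕ) (p : BS N M × A), (σa ^ n) p = (p.1 * (genA N M ^ n)⁻¹, p.2) := by
    intro n
    induction n with
    | zero => simp
    | succ n ih =>
      intro p
      rw [pow_succ, Equiv.Perm.mul_apply, ih, pow_succ]
      simp [σa, mul_assoc]
  have hrel : ∀ r ∈ ({FreeGroup.of Gen.a ^ N * FreeGroup.of Gen.b * (FreeGroup.of Gen.a ^ M)⁻¹ *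
      (FreeGroup.of Gen.b)⁻¹} : Set (FreeGroup Gen)), FreeGroup.lift f r = 1 := by
    intro r hr
    rw [Set.mem_singleton_iff.1 hr, map_mul, map_inv, mul_inv_eq_one, map_mul, map_inv,
      mul_inv_eq_iff_eq_mul]
    ext1 p
    simp only [map_mul, map_pow, FreeGroup.lift_apply_of, f, Equiv.Perm.mul_apply, hpow]
    have hg : p.1 * (genA N M ^ M)⁻¹ * (genB N M)⁻¹ =
        p.1 * (genB N M)⁻¹ * (genA N M ^ N)⁻¹ := by
      rw [mul_assoc p.1, mul_assoc p.1, ← mul_inv_rev, ← mul_inv_rev, genA_pow_mul_genB]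
    have hφ' : φ (p.1 * (genB N M)⁻¹ * (genA N M ^ N)⁻¹) = φ (p.1 * (genB N M)⁻¹) := by
      rw [← hφ, inv_mul_cancel_right]
    simp only [σb, Equiv.coe_fn_mk, hg, hφ']
  let ρ : BS N M →* Equiv.Perm (BS N M × A) := PresentedGroup.toGroup hrel
  have ha : ρ (genA N M) = σa := PresentedGroup.toGroup.of hrel
  have hb : ρ (genB N M) = σb := PresentedGroup.toGroup.of hrel
  have hfst : ∀ g : BS N M, ∀ p, (ρ g p).1 = p.1 * g⁻¹ := by
    intro g
    induction g using PresentedGroup.induction_on with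
    | _ w =>
      induction w using FreeGroup.induction_on with
      | C1 => simp
      | of x =>
        intro p
        cases x
        · exact congrArg (fun s => (s p).1) ha
        · exact congrArg (fun s => (s p).1) hb
      | inv_of x _ =>
        intro p
        rw [map_inv, map_inv]
        cases x
        · have h : (ρ (genA N M))⁻¹ p = σa.symm p := by rw [ha]; rfl
          exact (congrArg Prod.fst h).trans (by rw [inv_inv]; rfl)
        · have h : (ρ (genB N M))⁻¹ p = σb.symm p := by rw [hb]; rfl
          exact (congrArg Prod.fst h).trans (by rw [inv_inv]; rfl)
      | mul x y hx hy =>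
        intro p
        rw [map_mul, map_mul, Equiv.Perm.mul_apply, hx, hy, mul_inv_rev, mul_assoc]
  refine ⟨fun g => (ρ g⁻¹ (1, 0)).2, by simp, fun g => ?_, fun g => ?_⟩
  · have h : ρ (g * genA N M)⁻¹ (1, 0) = σa.symm (ρ g⁻¹ (1, 0)) := by
      rw [mul_inv_rev, map_mul, map_inv ρ (genA N M), ha]; rfl
    simp only [h]; rfl
  · have h : ρ (g * genB N M)⁻¹ (1, 0) = σb.symm (ρ g⁻¹ (1, 0)) := by
      rw [mul_inv_rev, map_mul, map_inv ρ (genB N M), hb]; rfl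
    have h1 : (ρ g⁻¹ (1, 0)).1 = g := by rw [hfst]; simp
    simp only [h]
    change (ρ g⁻¹ (1, 0)).2 + φ (ρ g⁻¹ (1, 0)).1 = _
    rw [h1]

theorem apply_mul_horo {A : Type*} {c : BS N M → A} (hc : ∀ g, c (g * genA N M) = c g)
    (g : BS N M) {h : BS N M} (hh : h ∈ horo N M) : c (g * h) = c g := by
  have hnat : ∀ (n : ℕ) (g : BS N M), c (g * genA N M ^ n) = c g := by
    intro n
    induction n with
    | zero => simp
    | succ n ih =>
      intro g
      rw [pow_succ, ← mul_assoc, hc, ih]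
  obtain ⟨k, rfl⟩ := hh
  obtain ⟨n, rfl | rfl⟩ := k.eq_nat_or_neg
  · simp [hnat]
  · simp only [zpow_neg, zpow_natCast]
    rw [← hnat n (g * _), inv_mul_cancel_right]

theorem natCast_dvd_of_zpow_mem [NeZero N] [NeZero M] {d : ℕ} {k : ℤ}
    (h : genA N M ^ k ∈ Subgroup.zpowers (genA N M ^ d)) : (d : ℤ) ∣ k := by
  obtain ⟨j, hj⟩ := h
  refine ⟨j, ?_⟩
  simp only [← zpow_natCast, ← zpow_mul] at hj
  exact (genA_zpow_injective N M hj).symm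

/-- The stabilizer in `⟨a⟩` of a neighbouring coset. The nontrivial direction counts the signed
crossings of the single edge from `⟨a⟩` to that coset. -/
theorem stable_inv_mul_zpow_mul_mem_iff [NeZero N] [NeZero M] (x : Bool) (k : ℤ) :
    (stable N M x)⁻¹ * genA N M ^ k * stable N M x ∈ horo N M ↔ (period N M x : ℤ) ∣ k := by
  classical
  constructor
  · intro h
    set h' := (stable N M x)⁻¹ * genA N M ^ k * stable N M x with hh'
    have e : genA N M ^ k * stable N M x = stable N M x * h' := by rw [hh']; group
    cases x
    -- The `b`-edges from `b⁻¹⟨a⟩` to `⟨a⟩` end in the elements of `⟨a^M⟩`.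
    · obtain ⟨c, c1, ca, cb⟩ := exists_cocycle
        (fun g : BS N M => if g * genB N M ∈ Subgroup.zpowers (genA N M ^ M) then (1 : ℤ) else 0)
        (fun g => by
          simp only [mul_assoc, genA_pow_mul_genB]
          simp only [← mul_assoc]
          simp only [Subgroup.mul_mem_cancel_right _ (Subgroup.mem_zpowers (genA N M ^ M))])
      have h0 : ∀ j : ℤ, c (genA N M ^ j) = 0 := fun j => by
        rw [← one_mul (genA N M ^ j), apply_mul_horo ca _ (Subgroup.zpow_mem_zpowers _ j), c1]
      have h1 := cb (stable N M false)
      have h2 := cb (genA N M ^ k * stable N M false)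
      rw [e, apply_mul_horo ca _ h, ← e] at h2
      simp only [stable, inv_mul_cancel, inv_mul_cancel_right, h0, c1, one_mem, if_true] at h1 h2
      by_contra hd
      rw [if_neg fun hm => hd (natCast_dvd_of_zpow_mem (N := N) (M := M) (d := M) hm)] at h2
      omega
    -- The `b`-edges from `⟨a⟩` to `b⟨a⟩` start in the elements of `⟨a^N⟩`.
    · obtain ⟨c, c1, ca, cb⟩ := exists_cocycle
        (fun g : BS N M => if g ∈ Subgroup.zpowers (genA N M ^ N) then (1 : ℤ) else 0)
        (fun g => by
          simp only [Subgroup.mul_mem_cancel_right _ (Subgroup.mem_zpowers (genA N M ^ N))])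
      have h0 : ∀ j : ℤ, c (genA N M ^ j) = 0 := fun j => by
        rw [← one_mul (genA N M ^ j), apply_mul_horo ca _ (Subgroup.zpow_mem_zpowers _ j), c1]
      have h1 := cb 1
      have h2 := cb (genA N M ^ k)
      change genA N M ^ k * genB N M = genB N M * h' at e
      rw [e, apply_mul_horo ca _ h] at h2
      rw [one_mul, c1, if_pos (one_mem _)] at h1
      rw [h0] at h2
      by_contra hd
      rw [if_neg fun hm => hd (natCast_dvd_of_zpow_mem (N := N) (M := M) (d := N) hm)] at h2
      omega
  · rintro ⟨j, rfl⟩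
    rw [mul_assoc (stable N M x)⁻¹, genA_zpow_mul_stable, inv_mul_cancel_left]
    exact Subgroup.zpow_mem_zpowers _ _

theorem zpow_mul_stable_eq_iff [NeZero N] [NeZero M] (x : Bool) (k : ℤ) :
    (∃ j : ℤ, genA N M ^ k * stable N M x = stable N M x * genA N M ^ j) ↔
      (period N M x : ℤ) ∣ k := by
  rw [← stable_inv_mul_zpow_mul_mem_iff (N := N) (M := M), Subgroup.mem_zpowers_iff]
  refine exists_congr fun j => ?_
  rw [mul_assoc (stable N M x)⁻¹, eq_inv_mul_iff_mul_eq, eq_comm]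

/-- The branch function: to an element outside `⟨a⟩` it assigns the neighbour of `⟨a⟩` through which
every path from `⟨a⟩` to that element leaves `⟨a⟩` for the last time, encoded as the indicator
function of this coset so that the values form a group. Such a function exists because removing the
coset `⟨a⟩` from the coset graph separates its neighbours from each other. -/
theorem exists_branch (N M : ℕ) : ∃ c : BS N M → (BS N M ⧸ horo N M → ℤ),
    (∀ g, c (g * genA N M) = c g) ∧
    (∀ h ∈ horo N M, ∀ x, ∀ p : BS N M ⧸ horo N M,
      c (h * stable N M x) p = 1 ↔ p = ↑(h * stable N M x)) ∧
    ∀ g x, g ∉ horo N M → g * stable N M x ∉ horo N M → c (g * stable N M x) = c g := by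
  classical
  let δ : BS N M ⧸ horo N M → BS N M ⧸ horo N M → ℤ := fun p q => if q = p then 1 else 0
  obtain ⟨c, c1, ca, cb⟩ := exists_cocycle
    (fun g : BS N M => (if g ∈ horo N M then δ ↑(g * genB N M) else 0) -
      (if g * genB N M ∈ horo N M then δ ↑g else 0))
    (fun g => by
      have hN : genA N M ^ N ∈ horo N M := pow_mem (Subgroup.mem_zpowers _) N
      have hM : genA N M ^ M ∈ horo N M := pow_mem (Subgroup.mem_zpowers _) M
      simp only [mul_assoc, genA_pow_mul_genB]
      simp only [← mul_assoc]
      simp only [Subgroup.mul_mem_cancel_right _ hN, Subgroup.mul_mem_cancel_right _ hM,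
        QuotientGroup.mk_mul_of_mem _ hN, QuotientGroup.mk_mul_of_mem _ hM])
  have h0 : ∀ h ∈ horo N M, c h = 0 := fun h hh => by
    rw [← one_mul h, apply_mul_horo ca _ hh, c1]
  have hs : ∀ h ∈ horo N M, ∀ x,
      c (h * stable N M x) = δ ↑(h * stable N M x) := by
    intro h hh x
    cases x
    · have h1 := cb (h * stable N M false)
      have h2 : h * stable N M false ∉ horo N M := by
        rw [Subgroup.mul_mem_cancel_left _ hh]; exact stable_notMem _
      have h3 : h * stable N M false * genB N M = h := by simp [stable]
      rw [if_neg h2, h3, if_pos hh, h0 _ hh, zero_sub, eq_comm, add_neg_eq_zero] at h1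
      exact h1
    · have h1 := cb h
      have h2 : h * genB N M ∉ horo N M := by
        rw [Subgroup.mul_mem_cancel_left _ hh]; exact stable_notMem true
      rwa [h0 _ hh, if_pos hh, if_neg h2, sub_zero, zero_add] at h1
  refine ⟨c, ca, fun h hh x p => ?_, fun g x hg hgx => ?_⟩
  · rw [hs h hh x]
    by_cases hp : p = ↑(h * stable N M x) <;> simp [δ, hp]
  · cases x
    · have h1 := cb (g * stable N M false)
      have h3 : g * stable N M false * genB N M = g := by simp [stable]
      rw [if_neg hgx, h3, if_neg hg, sub_zero, add_zero] at h1
      exact h1.symm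
    · have h1 := cb g
      rwa [if_neg hg, if_neg (show g * genB N M ∉ horo N M from hgx), sub_zero, add_zero] at h1

end Group

/-! ### Words: excursions from the horocyclic subgroup -/

section Words

variable (N M : ℕ)

/-- The exponent `k` of a word that generates `a^k`; the value is `0` for words outside `wordsH`. -/
noncomputable def expo (w : Word) : ℤ := by
  classical
  exact if h : ∃ k : ℤ, genA N M ^ k = eval N M w then h.choose else 0

/-- The words of `wordsH` no prefix of which generates an element `b a^j` (for `true`) or `b⁻¹ a^j`
(for `false`): these are `wordsL` and `wordsK`. -/
def avoiding (x : Bool) : Set Word :=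
  {w | w ∈ wordsH N M ∧
    ¬ ∃ u v : Word, w = u ++ v ∧ ∃ j : ℤ, eval N M u = stable N M x * genA N M ^ j}

/-- The words `v` such that the path of `b v b⁻¹` (for `true`) or `b⁻¹ v b` (for `false`), started
in `⟨a⟩`, leaves `⟨a⟩` with its first letter and returns with its last letter only. That `v` itself
generates an element of `⟨a⟩` is part of the definition; `path_closes` shows that it is no
restriction. -/
def excursions (x : Bool) : Set Word :=
  {v | v ∈ avoiding N M (!x) ∧ (period N M (!x) : ℤ) ∣ expo N M v}

/-- The word `u b v b⁻¹` (for `true`) or `u b⁻¹ v b` (for `false`). -/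
def detour (x : Bool) (u v : Word) : Word :=
  u ++ stableLetter x :: (v ++ [stableLetter (!x)])

variable {N M}

@[simp] theorem eval_nil : eval N M [] = 1 := rfl

@[simp] theorem eval_append (u v : Word) : eval N M (u ++ v) = eval N M u * eval N M v := by
  simp [eval]

@[simp] theorem eval_cons (s : Letter) (v : Word) :
    eval N M (s :: v) = s.toBS N M * eval N M v := by
  simp [eval]

@[simp] theorem toBS_stableLetter (x : Bool) : (stableLetter x).toBS N M = stable N M x := by
  cases x <;> rfl

theorem Letter.eq_stableLetter_or (s : Letter) :
    (∃ x, s = stableLetter x) ∨ s = Letter.a ∨ s = Letter.aInv := by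
  cases s
  · exact Or.inr (Or.inl rfl)
  · exact Or.inr (Or.inr rfl)
  · exact Or.inl ⟨true, rfl⟩
  · exact Or.inl ⟨false, rfl⟩

theorem Letter.toBS_mem_horo {s : Letter} (hs : s = Letter.a ∨ s = Letter.aInv) :
    s.toBS N M ∈ horo N M := by
  obtain rfl | rfl := hs
  · exact Subgroup.mem_zpowers _
  · exact inv_mem (Subgroup.mem_zpowers _)

theorem genA_zpow_expo {w : Word} (hw : w ∈ wordsH N M) : genA N M ^ expo N M w = eval N M w := by
  have h : ∃ k : ℤ, genA N M ^ k = eval N M w := hw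
  rw [expo, dif_pos h]
  exact h.choose_spec

theorem expo_eq_iff [NeZero N] [NeZero M] {w : Word} (hw : w ∈ wordsH N M) {k : ℤ} :
    expo N M w = k ↔ eval N M w = genA N M ^ k := by
  rw [← genA_zpow_expo hw]
  exact (genA_zpow_injective N M).eq_iff.symm

theorem nil_mem_wordsH : [] ∈ wordsH N M := one_mem (horo N M)

theorem append_mem_wordsH_iff (u : Word) {v : Word} (hv : v ∈ wordsH N M) :
    u ++ v ∈ wordsH N M ↔ u ∈ wordsH N M := by
  change eval N M (u ++ v) ∈ horo N M ↔ eval N M u ∈ horo N M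
  rw [eval_append, Subgroup.mul_mem_cancel_right _ hv]

theorem expo_append [NeZero N] [NeZero M] {u v : Word} (hu : u ∈ wordsH N M)
    (hv : v ∈ wordsH N M) : expo N M (u ++ v) = expo N M u + expo N M v := by
  rw [expo_eq_iff ((append_mem_wordsH_iff u hv).2 hu), eval_append, zpow_add, genA_zpow_expo hu,
    genA_zpow_expo hv]

theorem mul_stable_mul_mem_iff (x : Bool) {h : BS N M} (hh : h ∈ horo N M) (g : BS N M) :
    h * stable N M x * g ∈ horo N M ↔ ∃ j : ℤ, g = stable N M (!x) * genA N M ^ j := by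
  rw [mul_assoc h, Subgroup.mul_mem_cancel_left _ hh, Subgroup.mem_zpowers_iff]
  refine exists_congr fun j => ?_
  rw [stable_not, eq_inv_mul_iff_mul_eq, eq_comm]

/-- If a path that leaves `⟨a⟩` by a stable letter and stays outside `⟨a⟩` ends in a neighbour of
`⟨a⟩`, then this neighbour is the one it started with. -/
theorem coset_eq_of_path (x y : Bool) {h k : BS N M} (hh : h ∈ horo N M) (hk : k ∈ horo N M)
    {v : Word} (hv : ∀ p q : Word, v = p ++ q → h * stable N M x * eval N M p ∉ horo N M)
    (hvk : (k * stable N M y)⁻¹ * (h * stable N M x * eval N M v) ∈ horo N M) :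
    (k * stable N M y)⁻¹ * (h * stable N M x) ∈ horo N M := by
  obtain ⟨c, ca, hc, hoff⟩ := exists_branch N M
  have hconst : c (h * stable N M x * eval N M v) = c (h * stable N M x) := by
    clear hvk
    induction v using List.reverseRecOn with
    | nil => rw [eval_nil, mul_one]
    | append_singleton v s ih =>
      have ih' := ih fun p q hpq => hv p (q ++ [s]) (by rw [hpq, List.append_assoc])
      rw [← ih', eval_append, ← mul_assoc]
      obtain ⟨y, rfl⟩ | hs := s.eq_stableLetter_or
      · have h1 := hv v [stableLetter y] rfl
        have h2 := hv (v ++ [stableLetter y]) [] (by rw [List.append_nil])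
        rw [eval_append, ← mul_assoc] at h2
        simp only [eval_cons, eval_nil, mul_one, toBS_stableLetter] at h2 ⊢
        exact hoff _ y h1 h2
      · refine apply_mul_horo ca _ ?_
        rw [eval_cons, eval_nil, mul_one]
        exact Letter.toBS_mem_horo hs
  have hend : c (h * stable N M x * eval N M v) = c (k * stable N M y) := by
    rw [← apply_mul_horo ca (k * stable N M y) hvk, mul_inv_cancel_left]
  rw [hconst] at hend
  exact QuotientGroup.eq.1 ((hc h hh x _).1 (hend ▸ (hc k hk y _).2 rfl))

/-- A path that leaves `⟨a⟩` by a stable letter returns to `⟨a⟩` by the inverse letter, from the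
neighbour it first went to. -/
theorem path_closes (x y : Bool) {h : BS N M} (hh : h ∈ horo N M)
    {v : Word} (hv : ∀ p q : Word, v = p ++ q → h * stable N M x * eval N M p ∉ horo N M)
    (hvy : h * stable N M x * eval N M v * stable N M (!y) ∈ horo N M) :
    x = y ∧ v ∈ wordsH N M := by
  have e : (h * stable N M x * eval N M v * stable N M (!y) * stable N M y)⁻¹ *
      (h * stable N M x * eval N M v) = 1 := by
    rw [stable_not, inv_mul_cancel_right, inv_mul_cancel]
  have h1 := coset_eq_of_path x y hh hvy hv (by rw [e]; exact one_mem _)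
  have h2 : eval N M v ∈ horo N M := by
    have h3 := inv_mem h1
    rw [stable_not, inv_mul_cancel_right, mul_inv_rev, inv_inv, inv_mul_cancel_left] at h3
    exact h3
  refine ⟨?_, h2⟩
  by_contra hxy
  have hxy' : (!y) = x := by cases x <;> cases y <;> simp_all
  rw [hxy', mul_assoc h, mul_assoc h, Subgroup.mul_mem_cancel_left _ hh] at hvy
  exact stable_mul_mul_stable_notMem x h2 hvy

theorem nil_mem_avoiding (x : Bool) : [] ∈ avoiding N M x := by
  refine ⟨nil_mem_wordsH, ?_⟩
  rintro ⟨u, v, huv, j, hj⟩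
  obtain ⟨rfl, rfl⟩ := List.append_eq_nil_iff.1 huv.symm
  refine stable_notMem (N := N) (M := M) x ⟨-j, ?_⟩
  rw [eval_nil] at hj
  simp only [zpow_neg]
  rw [eq_comm, eq_inv_iff_mul_eq_one, ← hj]

theorem notMem_of_mem_avoiding {x : Bool} {v : Word} (hv : v ∈ avoiding N M (!x))
    {h : BS N M} (hh : h ∈ horo N M) (p q : Word) (hpq : v = p ++ q) :
    h * stable N M x * eval N M p ∉ horo N M := fun hp =>
  hv.2 ⟨p, q, hpq, (mul_stable_mul_mem_iff x hh _).1 hp⟩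

theorem append_mem_avoiding_iff (x : Bool) (u : Word) {s : Letter}
    (hs : s = Letter.a ∨ s = Letter.aInv) :
    u ++ [s] ∈ avoiding N M x ↔ u ∈ avoiding N M x := by
  have hs' : [s] ∈ wordsH N M := by
    change eval N M [s] ∈ horo N M
    rw [eval_cons, eval_nil, mul_one]
    exact Letter.toBS_mem_horo hs
  constructor
  · rintro ⟨h1, h2⟩
    refine ⟨(append_mem_wordsH_iff u hs').1 h1, ?_⟩
    rintro ⟨p, q, rfl, hp⟩
    exact h2 ⟨p, q ++ [s], List.append_assoc .., hp⟩
  · rintro ⟨h1, h2⟩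
    have h3 := (append_mem_wordsH_iff u hs').2 h1
    refine ⟨h3, ?_⟩
    rintro ⟨p, q, hpq, j, hj⟩
    obtain rfl | ⟨q, t, rfl⟩ := List.eq_nil_or_concat' q
    · rw [List.append_nil] at hpq
      rw [← hpq] at hj
      change eval N M (u ++ [s]) ∈ horo N M at h3
      rw [hj, Subgroup.mul_mem_cancel_right _ (Subgroup.zpow_mem_zpowers _ _)] at h3
      exact stable_notMem x h3
    · rw [← List.append_assoc] at hpq
      exact h2 ⟨p, q, (List.append_inj' hpq rfl).1, j, hj⟩

/-- The last visit to `⟨a⟩` of a path that ends outside `⟨a⟩`. -/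
theorem exists_last_visit (w : Word) (hw : w ∉ wordsH N M) :
    ∃ u x v, w = u ++ stableLetter x :: v ∧ u ∈ wordsH N M ∧
      ∀ p q : Word, v = p ++ q → eval N M u * stable N M x * eval N M p ∉ horo N M := by
  induction w using List.reverseRecOn with
  | nil => exact absurd nil_mem_wordsH hw
  | append_singleton w s ih =>
    by_cases hw' : w ∈ wordsH N M
    · obtain ⟨x, rfl⟩ | hs := s.eq_stableLetter_or
      · refine ⟨w, x, [], rfl, hw', fun p q hpq => ?_⟩
        obtain ⟨rfl, rfl⟩ := List.append_eq_nil_iff.1 hpq.symm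
        rw [eval_nil, mul_one, Subgroup.mul_mem_cancel_left _ hw']
        exact stable_notMem x
      · refine absurd ((append_mem_wordsH_iff w ?_).2 hw') hw
        change eval N M [s] ∈ horo N M
        rw [eval_cons, eval_nil, mul_one]
        exact Letter.toBS_mem_horo hs
    · obtain ⟨u, x, v, rfl, hu, hv⟩ := ih hw'
      refine ⟨u, x, v ++ [s], by simp, hu, fun p q hpq => ?_⟩
      obtain rfl | ⟨q, t, rfl⟩ := List.eq_nil_or_concat' q
      · rw [List.append_nil] at hpq
        intro hp
        refine hw ?_
        change eval N M _ ∈ horo N M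
        rw [List.append_assoc, List.cons_append, hpq, eval_append, eval_cons, ← mul_assoc,
          toBS_stableLetter]
        exact hp
      · rw [← List.append_assoc] at hpq
        exact hv p q (List.append_inj' hpq rfl).1

theorem length_detour (x : Bool) (u v : Word) :
    (detour x u v).length = u.length + v.length + 2 := by
  simp [detour]; omega

theorem eval_detour (x : Bool) (u v : Word) :
    eval N M (detour x u v) =
      eval N M u * (stable N M x * eval N M v * stable N M (!x)) := by
  simp [detour, mul_assoc (stable N M x)]

theorem stable_conj_zpow (x : Bool) (k : ℤ) :
    stable N M x * genA N M ^ (period N M (!x) * k) * stable N M (!x) =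
      genA N M ^ (period N M x * k) := by
  rw [← genA_zpow_mul_stable, stable_not, mul_inv_cancel_right]

theorem eval_detour_of_mem [NeZero N] [NeZero M] {x : Bool} {u v : Word} (hu : u ∈ wordsH N M)
    (hv : v ∈ excursions N M x) : eval N M (detour x u v) =
      genA N M ^ (expo N M u + period N M x * (expo N M v / period N M (!x))) := by
  rw [eval_detour, zpow_add, ← stable_conj_zpow, genA_zpow_expo hu, Int.mul_ediv_cancel' hv.2,
    genA_zpow_expo hv.1.1]

theorem detour_mem_wordsH [NeZero N] [NeZero M] {x : Bool} {u v : Word} (hu : u ∈ wordsH N M)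
    (hv : v ∈ excursions N M x) : detour x u v ∈ wordsH N M :=
  ⟨_, (eval_detour_of_mem hu hv).symm⟩

theorem expo_detour [NeZero N] [NeZero M] {x : Bool} {u v : Word} (hu : u ∈ wordsH N M)
    (hv : v ∈ excursions N M x) : expo N M (detour x u v) =
      expo N M u + period N M x * (expo N M v / period N M (!x)) :=
  (expo_eq_iff (detour_mem_wordsH hu hv)).2 (eval_detour_of_mem hu hv)

/-- A word of `wordsH` that ends in a stable letter is cut at its last visit to `⟨a⟩` before the
end. -/
theorem exists_detour [NeZero N] [NeZero M] {x : Bool} {w : Word}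
    (hw : w ++ [stableLetter (!x)] ∈ wordsH N M) :
    ∃ u ∈ wordsH N M, ∃ v ∈ excursions N M x, detour x u v = w ++ [stableLetter (!x)] := by
  have hw0 : w ∉ wordsH N M := fun h => by
    change eval N M _ ∈ horo N M at hw
    rw [eval_append, Subgroup.mul_mem_cancel_left _ h, eval_cons, eval_nil, mul_one,
      toBS_stableLetter] at hw
    exact stable_notMem _ hw
  obtain ⟨u, y, v, rfl, hu, hv⟩ := exists_last_visit w hw0
  have hw' : eval N M u * stable N M y * eval N M v * stable N M (!x) ∈ horo N M := by
    have h1 : eval N M _ ∈ horo N M := hw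
    rw [eval_append, eval_append, eval_cons, eval_cons, eval_nil, mul_one, toBS_stableLetter,
      toBS_stableLetter, ← mul_assoc (eval N M u)] at h1
    exact h1
  obtain ⟨rfl, hvH⟩ := path_closes y x hu hv hw'
  refine ⟨u, hu, v, ⟨⟨hvH, ?_⟩, ?_⟩, by simp [detour]⟩
  · rintro ⟨p, q, hpq, hp⟩
    exact hv p q hpq ((mul_stable_mul_mem_iff y hu _).2 hp)
  · rw [mul_assoc (eval N M u), mul_assoc (eval N M u), Subgroup.mul_mem_cancel_left _ hu,
      ← genA_zpow_expo hvH] at hw'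
    rw [← stable_inv_mul_zpow_mul_mem_iff (N := N) (M := M), stable_not, inv_inv, ← stable_not]
    exact hw'

/-- A cut that is followed by a path outside `⟨a⟩` is the last possible one. -/
theorem length_le_of_append_eq {x : Bool} {u u' v v' : Word} (hu' : u' ∈ wordsH N M)
    (hu : u ∈ wordsH N M) (hv : v ∈ avoiding N M (!x))
    (h : u ++ stableLetter x :: v = u' ++ stableLetter x :: v') : u'.length ≤ u.length := by
  obtain ⟨t, rfl, ht⟩ | ⟨t, rfl, ht⟩ := List.append_eq_append_iff.1 h
  · rcases t with _ | ⟨s, t⟩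
    · simp
    · exfalso
      rw [List.cons_append, List.cons.injEq] at ht
      obtain ⟨rfl, ht⟩ := ht
      refine notMem_of_mem_avoiding hv hu t _ ht ?_
      have h1 : eval N M _ ∈ horo N M := hu'
      rwa [eval_append, eval_cons, toBS_stableLetter, ← mul_assoc] at h1
  · simp

theorem detour_injOn {x : Bool} {u u' v v' : Word} (hu : u ∈ wordsH N M) (hu' : u' ∈ wordsH N M)
    (hv : v ∈ avoiding N M (!x)) (hv' : v' ∈ avoiding N M (!x))
    (h : detour x u v = detour x u' v') : u = u' ∧ v = v' := by
  rw [detour, detour, ← List.cons_append, ← List.cons_append, ← List.append_assoc,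
    ← List.append_assoc] at h
  have h1 := (List.append_inj' h rfl).1
  obtain ⟨rfl, h2⟩ := List.append_inj h1 (le_antisymm
    (length_le_of_append_eq hu hu' hv' h1.symm) (length_le_of_append_eq hu' hu hv h1))
  exact ⟨rfl, (List.cons.inj h2).2⟩

theorem mul_stable_eq_iff [NeZero N] [NeZero M] (x y : Bool) {u : Word} (hu : u ∈ wordsH N M) :
    (∃ j : ℤ, eval N M u * stable N M x = stable N M y * genA N M ^ j) ↔
      x = y ∧ (period N M y : ℤ) ∣ expo N M u := by
  constructor
  · rintro ⟨j, hj⟩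
    have hxy : x = y := by
      by_contra hxy
      have hxy' : x = !y := by cases x <;> cases y <;> simp_all
      subst hxy'
      refine stable_mul_mul_stable_notMem (!y) hu ?_
      rw [mul_assoc (stable N M (!y)), hj, stable_not, inv_mul_cancel_left]
      exact Subgroup.zpow_mem_zpowers _ _
    subst hxy
    refine ⟨rfl, (zpow_mul_stable_eq_iff (N := N) (M := M) x _).1 ⟨j, ?_⟩⟩
    rw [genA_zpow_expo hu, hj]
  · rintro ⟨rfl, h⟩
    obtain ⟨j, hj⟩ := (zpow_mul_stable_eq_iff (N := N) (M := M) x _).2 h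
    exact ⟨j, by rw [← genA_zpow_expo hu, hj]⟩

/-- A detour avoids a neighbour of `⟨a⟩` if and only if its initial part does and its excursion does
not go to that neighbour: by the separation property the excursion meets no other neighbour. -/
theorem detour_mem_avoiding_iff [NeZero N] [NeZero M] (x y : Bool) {u v : Word}
    (hu : u ∈ wordsH N M) (hv : v ∈ excursions N M x) :
    detour x u v ∈ avoiding N M y ↔
      u ∈ avoiding N M y ∧ ¬ (x = y ∧ (period N M y : ℤ) ∣ expo N M u) := by
  have hH := detour_mem_wordsH hu hv
  rw [← mul_stable_eq_iff x y hu]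
  constructor
  · rintro ⟨-, h2⟩
    refine ⟨⟨hu, ?_⟩, ?_⟩
    · rintro ⟨p, q, rfl, hp⟩
      exact h2 ⟨p, _, List.append_assoc .., hp⟩
    · rintro ⟨j, hj⟩
      refine h2 ⟨u ++ [stableLetter x], v ++ [stableLetter (!x)], by simp [detour], j, ?_⟩
      simpa using hj
  · rintro ⟨⟨-, h1⟩, h2⟩
    refine ⟨hH, ?_⟩
    rintro ⟨p, q, hpq, j, hj⟩
    obtain ⟨t, rfl, ht⟩ | ⟨t, rfl, ht⟩ := List.append_eq_append_iff.1 hpq.symm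
    · exact h1 ⟨p, t, rfl, j, hj⟩
    · rcases t with _ | ⟨s, t⟩
      · exact h1 ⟨u, [], by simp, j, by simpa using hj⟩
      · rw [List.cons_append, List.cons.injEq] at ht
        obtain ⟨rfl, ht⟩ := ht
        rw [eval_append, eval_cons, toBS_stableLetter, ← mul_assoc] at hj
        have key : ∀ r, v = t ++ r → False := fun r hr => by
          have h3 := coset_eq_of_path x y hu (one_mem _)
            (fun p q hpq => notMem_of_mem_avoiding hv.1 hu p (q ++ r)
              (by rw [hr, hpq, List.append_assoc])) (v := t) (by
              rw [hj, one_mul, inv_mul_cancel_left]; exact Subgroup.zpow_mem_zpowers _ _)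
          obtain ⟨i, hi⟩ := h3
          refine h2 ⟨i, ?_⟩
          simp only [one_mul] at hi
          rw [hi, mul_inv_cancel_left]
        obtain ⟨r, hr, -⟩ | ⟨r, hr, hr'⟩ := List.append_eq_append_iff.1 ht.symm
        · exact key r hr
        · rcases r with _ | ⟨s, r⟩
          · exact key [] (by rw [hr]; simp)
          · rw [List.cons_append, List.cons.injEq] at hr'
            obtain ⟨rfl, hr'⟩ := hr'
            obtain ⟨rfl, rfl⟩ := List.append_eq_nil_iff.1 hr'.symm
            have h3 : eval N M _ ∈ horo N M := hH
            rw [eval_detour] at h3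
            rw [hr, eval_append, eval_cons, eval_nil, mul_one, toBS_stableLetter, mul_assoc,
              ← mul_assoc (stable N M x)] at hj
            rw [hj, Subgroup.mul_mem_cancel_right _ (Subgroup.zpow_mem_zpowers _ _)] at h3
            exact stable_notMem y h3

end Words

/-! ### Generating functions of weighted sets of words -/

section Series

/-- The finset of words of a given length. -/
noncomputable def wordsOfLength (n : ℕ) : Finset Word := (List.finite_length_eq Letter n).toFinset

@[simp] theorem mem_wordsOfLength {n : ℕ} {w : Word} : w ∈ wordsOfLength n ↔ w.length = n := by
  simp [wordsOfLength]

open Classical in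
/-- The generating function `∑ z^|w| q^(e w)`, over the words `w` in `S`. -/
noncomputable def series (S : Set Word) (e : Word → ℤ) : PowerSeries ℤ[T;T⁻¹] :=
  PowerSeries.mk fun n => ∑ w ∈ wordsOfLength n with w ∈ S, T (e w)

theorem series_congr {S : Set Word} {e e' : Word → ℤ} (h : ∀ w ∈ S, e w = e' w) :
    series S e = series S e' := by
  classical
  ext1 n
  simp only [series, PowerSeries.coeff_mk]
  exact Finset.sum_congr rfl fun w hw => by rw [h w (Finset.mem_filter.1 hw).2]

theorem series_eq_add (S P : Set Word) (e : Word → ℤ) :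
    series S e = series (S ∩ P) e + series (S \ P) e := by
  classical
  ext1 n
  simp only [series, PowerSeries.coeff_mk, map_add, Finset.sum_filter, ← Finset.sum_add_distrib]
  refine Finset.sum_congr rfl fun w _ => ?_
  by_cases hS : w ∈ S <;> by_cases hP : w ∈ P <;> simp [hS, hP]

theorem series_nil (e : Word → ℤ) : series {[]} e = PowerSeries.C (T (e [])) := by
  classical
  ext1 n
  simp only [series, PowerSeries.coeff_mk, PowerSeries.coeff_C, Set.mem_singleton_iff]
  split_ifs with hn
  · subst hn
    rw [show (wordsOfLength 0).filter (· = []) = {[]} by ext w; simp +contextual,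
      Finset.sum_singleton]
  · rw [Finset.filter_eq_empty_iff.2, Finset.sum_empty]
    rintro w hw rfl
    exact hn (mem_wordsOfLength.1 hw).symm

/-- The product formula: the generating function of the words `m u v` that are assembled uniquely
from `u ∈ S` and `v ∈ T` by an operation that adds `d` letters. -/
theorem series_image2 {S T' : Set Word} {e e₁ e₂ : Word → ℤ} {m : Word → Word → Word} {d : ℕ}
    (hlen : ∀ u v, (m u v).length = u.length + v.length + d)
    (hinj : ∀ u ∈ S, ∀ u' ∈ S, ∀ v ∈ T', ∀ v' ∈ T', m u v = m u' v' → u = u' ∧ v = v')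
    (he : ∀ u ∈ S, ∀ v ∈ T', e (m u v) = e₁ u + e₂ v) :
    series (Set.image2 m S T') e = PowerSeries.X ^ d * (series S e₁ * series T' e₂) := by
  classical
  ext1 n
  rw [PowerSeries.coeff_X_pow_mul']
  split_ifs with hd
  · obtain ⟨n, rfl⟩ := Nat.exists_eq_add_of_le' hd
    rw [Nat.add_sub_cancel, PowerSeries.coeff_mul]
    simp only [series, PowerSeries.coeff_mk, Finset.sum_mul_sum]
    simp only [← Finset.sum_product']
    rw [Finset.sum_sigma']
    symm
    refine Finset.sum_bij (fun p _ => m p.2.1 p.2.2) ?_ ?_ ?_ ?_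
    · rintro ⟨⟨i, j⟩, u, v⟩ h
      simp only [Finset.mem_sigma, Finset.HasAntidiagonal.mem_antidiagonal,
        Finset.mem_product, Finset.mem_filter, mem_wordsOfLength] at h ⊢
      exact ⟨by rw [hlen]; omega, u, h.2.1.2, v, h.2.2.2, rfl⟩
    · rintro ⟨⟨i, j⟩, u, v⟩ h ⟨⟨i', j'⟩, u', v'⟩ h' heq
      simp only [Finset.mem_sigma, Finset.HasAntidiagonal.mem_antidiagonal,
        Finset.mem_product, Finset.mem_filter, mem_wordsOfLength] at h h'
      obtain ⟨rfl, rfl⟩ := hinj u h.2.1.2 u' h'.2.1.2 v h.2.2.2 v' h'.2.2.2 heq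
      obtain ⟨-, ⟨rfl, -⟩, rfl, -⟩ := h
      obtain ⟨-, ⟨rfl, -⟩, rfl, -⟩ := h'
      rfl
    · intro w hw
      simp only [Finset.mem_filter, mem_wordsOfLength] at hw
      obtain ⟨hw, u, hu, v, hv, rfl⟩ := hw
      refine ⟨⟨(u.length, v.length), u, v⟩, ?_, rfl⟩
      simp only [Finset.mem_sigma, Finset.HasAntidiagonal.mem_antidiagonal,
        Finset.mem_product, Finset.mem_filter, mem_wordsOfLength]
      rw [hlen] at hw
      exact ⟨by omega, ⟨trivial, hu⟩, trivial, hv⟩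
    · rintro ⟨⟨i, j⟩, u, v⟩ h
      simp only [Finset.mem_sigma, Finset.mem_product, Finset.mem_filter] at h
      rw [he u h.2.1.2 v h.2.2.2, T_add]
  · simp only [series, PowerSeries.coeff_mk]
    rw [Finset.filter_eq_empty_iff.2, Finset.sum_empty]
    rintro _ hw ⟨u, -, v, -, rfl⟩
    rw [mem_wordsOfLength, hlen] at hw
    omega

theorem series_append_letter {S : Set Word} {e : Word → ℤ} {s : Letter} {k : ℤ}
    (he : ∀ u ∈ S, e (u ++ [s]) = e u + k) :
    series ((· ++ [s]) '' S) e = z * qPow k * series S e := by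
  have h := series_image2 (S := S) (T' := {[]}) (e := e) (e₁ := e) (e₂ := fun _ => k) (d := 1)
    (m := fun u v => u ++ [s] ++ v) (fun u v => by simp; omega)
    (by
      rintro u - u' - v rfl v' rfl h
      simpa using h)
    (by
      rintro u hu v rfl
      simpa using he u hu)
  rw [Set.image2_singleton_right, series_nil, pow_one] at h
  simp only [List.append_nil] at h
  rw [h, z, qPow]
  ring

theorem Phi_series (d e' : ℕ) (S : Set Word) (e : Word → ℤ) :
    Phi d e' (series S e) =
      series {w | w ∈ S ∧ (d : ℤ) ∣ e w} (fun w => e' * (e w / d)) := by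
  classical
  -- The operator acts on each coefficient of `z ^ n` by an additive map.
  let φ : ℤ[T;T⁻¹] →+ ℤ[T;T⁻¹] :=
    (Finsupp.liftAddHom fun k : ℤ => if (d : ℤ) ∣ k then
      AddMonoidAlgebra.singleAddHom ((e' : ℤ) * (k / d)) else 0).comp
      AddMonoidAlgebra.coeffAddEquiv.toAddMonoidHom
  have hφ : ∀ p : ℤ[T;T⁻¹], φ p = p.coeff.sum fun k c =>
      if (d : ℤ) ∣ k then AddMonoidAlgebra.single ((e' : ℤ) * (k / d)) c else 0 := by
    intro p
    change Finsupp.liftAddHom _ p.coeff = _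
    rw [Finsupp.liftAddHom_apply]
    refine Finsupp.sum_congr fun k _ => ?_
    split_ifs <;> rfl
  have hT : ∀ k : ℤ, φ (T k) = if (d : ℤ) ∣ k then T ((e' : ℤ) * (k / d)) else 0 := by
    intro k
    rw [hφ, T, AddMonoidAlgebra.coeff_single, Finsupp.sum_single_index (by simp)]
    rfl
  ext1 n
  simp only [Phi, series, PowerSeries.coeff_mk]
  rw [← hφ, map_sum, Finset.sum_filter, Finset.sum_filter]
  refine Finset.sum_congr rfl fun w _ => ?_
  rw [hT]
  by_cases hS : w ∈ S <;> by_cases hd : (d : ℤ) ∣ e w <;> simp [hS, hd]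

theorem genFun_eq_series (N M : ℕ) [NeZero N] [NeZero M] {S : Set Word} (hS : S ⊆ wordsH N M) :
    genFun N M S = series S (expo N M) := by
  classical
  ext n k
  simp only [genFun, series, PowerSeries.coeff_mk, AddMonoidAlgebra.coeff_sum,
    Finsupp.coe_finsetSum, Finset.sum_apply, T_apply]
  change (count N M S n k : ℤ) = _
  rw [Finset.sum_boole, count, ← Set.ncard_coe_finset]
  congr 2
  ext w
  simp only [Set.mem_ofPred_eq, Finset.coe_filter, Finset.mem_filter, mem_wordsOfLength]
  constructor
  · rintro ⟨h1, h2, h3⟩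
    exact ⟨⟨h2, h1⟩, (expo_eq_iff (hS h1)).2 h3⟩
  · rintro ⟨⟨h2, h1⟩, h3⟩
    exact ⟨h1, h2, (expo_eq_iff (hS h1)).1 h3⟩

end Series

/-! ### The functional equations -/

section Equations

variable {N M : ℕ}

theorem avoiding_subset (x : Bool) : avoiding N M x ⊆ wordsH N M := fun _ h => h.1

variable [NeZero N] [NeZero M]

theorem series_excursions (x : Bool) :
    series (excursions N M x) (fun v => period N M x * (expo N M v / period N M (!x))) =
      Phi (period N M (!x)) (period N M x) (genFun N M (avoiding N M (!x))) := by
  rw [genFun_eq_series N M (avoiding_subset _), Phi_series]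
  rfl

theorem series_detour (x : Bool) {U : Set Word} (hU : U ⊆ wordsH N M) :
    series (Set.image2 (detour x) U (excursions N M x)) (expo N M) =
      z ^ 2 * (genFun N M U *
        Phi (period N M (!x)) (period N M x) (genFun N M (avoiding N M (!x)))) := by
  rw [series_image2 (e₁ := expo N M)
    (e₂ := fun v => period N M x * (expo N M v / period N M (!x))) (length_detour x)
    (fun u hu u' hu' v hv v' hv' => detour_injOn (hU hu) (hU hu') hv.1 hv'.1)
    (fun u hu v hv => expo_detour (hU hu) hv), series_excursions, genFun_eq_series N M hU, z]

/-- The functional equation of a set `S` of words that generate elements of `⟨a⟩`, from the last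
letter of the words: `S` contains the empty word, is stable under appending and removing final
letters `a` and `a⁻¹`, and contains those detours whose initial parts belong to `U`. -/
theorem genFun_eq_of_detour {S : Set Word} (U : Bool → Set Word) (hS : S ⊆ wordsH N M)
    (hU : ∀ x, U x ⊆ wordsH N M) (hnil : [] ∈ S)
    (ha : ∀ u s, s = Letter.a ∨ s = Letter.aInv → (u ++ [s] ∈ S ↔ u ∈ S))
    (hdetour : ∀ x, ∀ u ∈ wordsH N M, ∀ v ∈ excursions N M x, detour x u v ∈ S ↔ u ∈ U x) :
    genFun N M S = 1 + z * (qPow 1 + qPow (-1)) * genFun N M S +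
      z ^ 2 * (genFun N M (U true) * Phi M N (genFun N M (avoiding N M false)) +
        genFun N M (U false) * Phi N M (genFun N M (avoiding N M true))) := by
  let E : Letter → Set Word := fun s => {w | ∃ u, w = u ++ [s]}
  have hdlast : ∀ x u v, detour x u v = (u ++ stableLetter x :: v) ++ [stableLetter (!x)] :=
    fun x u v => by simp [detour]
  have hA : ∀ u ∈ S, expo N M (u ++ [Letter.a]) = expo N M u + 1 := fun u hu => by
    have h1 : [Letter.a] ∈ wordsH N M := ⟨1, by simp [Letter.toBS]⟩
    rw [expo_append (hS hu) h1, (expo_eq_iff (k := 1) h1).2 (by simp [Letter.toBS])]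
  have hA' : ∀ u ∈ S, expo N M (u ++ [Letter.aInv]) = expo N M u + -1 := fun u hu => by
    have h1 : [Letter.aInv] ∈ wordsH N M := ⟨-1, by simp [Letter.toBS]⟩
    rw [expo_append (hS hu) h1, (expo_eq_iff (k := -1) h1).2 (by simp [Letter.toBS])]
  have e0 : S ∩ {[]} = {[]} := by simpa using hnil
  have e1 : ∀ s, s = Letter.a ∨ s = Letter.aInv →
      S ∩ E s = (· ++ [s]) '' S := by
    intro s hs
    ext w
    constructor
    · rintro ⟨hw, u, rfl⟩
      exact ⟨u, (ha u s hs).1 hw, rfl⟩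
    · rintro ⟨u, hu, rfl⟩
      exact ⟨(ha u s hs).2 hu, u, rfl⟩
  have e2 : ∀ x, S ∩ E (stableLetter (!x)) =
      Set.image2 (detour x) (U x) (excursions N M x) := by
    intro x
    ext w
    constructor
    · rintro ⟨hw, u, rfl⟩
      obtain ⟨u, hu, v, hv, h⟩ := exists_detour (hS hw)
      rw [← h] at hw ⊢
      exact ⟨u, (hdetour x u hu v hv).1 hw, v, hv, rfl⟩
    · rintro ⟨u, hu, v, hv, rfl⟩
      exact ⟨(hdetour x u (hU x hu) v hv).2 hu, _, hdlast x u v⟩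
  -- Split `S` into the empty word and the words with a given last letter.
  have key : series S (expo N M) = series (S ∩ {[]}) (expo N M) +
      (series (S ∩ E Letter.a) (expo N M) + (series (S ∩ E Letter.aInv) (expo N M) +
      (series (S ∩ E Letter.bInv) (expo N M) + series (S ∩ E Letter.b) (expo N M)))) := by
    have step : ∀ (R : Set Word) (s : Letter), E s ⊆ R → series (S ∩ R) (expo N M) =
        series (S ∩ E s) (expo N M) + series (S ∩ (R \ E s)) (expo N M) := by
      intro R s hR
      rw [series_eq_add (S ∩ R) (E s), Set.inter_sdiff_assoc, Set.inter_assoc,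
        Set.inter_eq_right.2 hR]
    rw [series_eq_add S {[]}, Set.sdiff_eq, step {[]}ᶜ Letter.a,
      step ({[]}ᶜ \ E Letter.a) Letter.aInv,
      step (({[]}ᶜ \ E Letter.a) \ E Letter.aInv) Letter.bInv]
    · congr 6
      ext w
      obtain rfl | ⟨u, s, rfl⟩ := List.eq_nil_or_concat' w
      · simp [E]
      · cases s <;> simp [E]
    all_goals
      rintro _ ⟨u, rfl⟩
      simp [E]
  rw [e0, e1 _ (Or.inl rfl), e1 _ (Or.inr rfl), series_append_letter hA,
    series_append_letter hA'] at key
  have h1 := e2 true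
  have h2 := e2 false
  simp only [stableLetter, Bool.not_true, Bool.not_false] at h1 h2
  rw [h1, h2, series_detour true (hU true), series_detour false (hU false), series_nil,
    (expo_eq_iff nil_mem_wordsH).2 (zpow_zero _).symm, T_zero, map_one,
    ← genFun_eq_series N M hS] at key
  simp only [Bool.not_true, Bool.not_false, period] at key
  linear_combination key

theorem genFun_avoiding_diff (x : Bool) :
    genFun N M {u | u ∈ avoiding N M x ∧ ¬ (period N M x : ℤ) ∣ expo N M u} =
      genFun N M (avoiding N M x) -
        Phi (period N M x) (period N M x) (genFun N M (avoiding N M x)) := by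
  rw [genFun_eq_series N M (avoiding_subset x), genFun_eq_series N M fun _ h => h.1.1, Phi_series,
    series_congr (e' := expo N M) fun w hw => Int.mul_ediv_cancel' hw.2, eq_sub_iff_add_eq',
    eq_comm]
  exact series_eq_add _ {u | (period N M x : ℤ) ∣ expo N M u} _

theorem genFun_avoiding (x : Bool) :
    genFun N M (avoiding N M x) = 1 + z * (qPow 1 + qPow (-1)) * genFun N M (avoiding N M x) +
      z ^ 2 * genFun N M (avoiding N M x) * (Phi N M (L N M) + Phi M N (K N M)) -
      z ^ 2 * Phi (period N M (!x)) (period N M x) (genFun N M (avoiding N M (!x))) *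
        Phi (period N M x) (period N M x) (genFun N M (avoiding N M x)) := by
  have h := genFun_eq_of_detour (S := avoiding N M x)
    (fun y => {u | u ∈ avoiding N M x ∧ ¬ (y = x ∧ (period N M x : ℤ) ∣ expo N M u)})
    (avoiding_subset x) (fun _ _ h => h.1.1) (nil_mem_avoiding x)
    (fun u s hs => append_mem_avoiding_iff x u hs)
    (fun y u hu v hv => detour_mem_avoiding_iff y x hu hv)
  have h' := genFun_avoiding_diff (N := N) (M := M) x
  cases x
  · simp only [Bool.true_eq_false, false_and, not_false_eq_true, and_true, true_and,
      Set.ofPred_mem_eq] at h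
    rw [h'] at h
    change K N M = 1 + z * (qPow 1 + qPow (-1)) * K N M + z ^ 2 * (K N M * Phi M N (K N M) +
      (K N M - Phi M M (K N M)) * Phi N M (L N M)) at h
    change K N M = 1 + z * (qPow 1 + qPow (-1)) * K N M + z ^ 2 * K N M *
      (Phi N M (L N M) + Phi M N (K N M)) - z ^ 2 * Phi N M (L N M) * Phi M M (K N M)
    linear_combination h
  · simp only [Bool.false_eq_true, false_and, not_false_eq_true, and_true, true_and,
      Set.ofPred_mem_eq] at h
    rw [h'] at h
    change L N M = 1 + z * (qPow 1 + qPow (-1)) * L N M +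
      z ^ 2 * ((L N M - Phi N N (L N M)) * Phi M N (K N M) + L N M * Phi N M (L N M)) at h
    change L N M = 1 + z * (qPow 1 + qPow (-1)) * L N M + z ^ 2 * L N M *
      (Phi N M (L N M) + Phi M N (K N M)) - z ^ 2 * Phi M N (K N M) * Phi N N (L N M)
    linear_combination h

theorem genFun_wordsH : G N M = 1 + z * (qPow 1 + qPow (-1)) * G N M +
    z ^ 2 * G N M * (Phi N M (L N M) + Phi M N (K N M)) := by
  have h := genFun_eq_of_detour (S := wordsH N M) (fun _ => wordsH N M) subset_rfl
    (fun _ => subset_rfl) nil_mem_wordsH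
    (fun u s hs => append_mem_wordsH_iff u (by
      change eval N M [s] ∈ horo N M
      rw [eval_cons, eval_nil, mul_one]
      exact Letter.toBS_mem_horo hs))
    (fun x u hu v hv => iff_of_true (detour_mem_wordsH hu hv) hu)
  change G N M = 1 + z * (qPow 1 + qPow (-1)) * G N M +
    z ^ 2 * (G N M * Phi M N (K N M) + G N M * Phi N M (L N M)) at h
  linear_combination h

end Equations

end BaumslagSolitar

theorem mainTheorem2 (N M : ℕ) [NeZero N] [NeZero M] :
    (L N M = 1 + z * (qPow 1 + qPow (-1)) * L N M
        + z ^ 2 * L N M * (Phi N M (L N M) + Phi M N (K N M))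
        - z ^ 2 * Phi M N (K N M) * Phi N N (L N M)) ∧
    (K N M = 1 + z * (qPow 1 + qPow (-1)) * K N M
        + z ^ 2 * K N M * (Phi M N (K N M) + Phi N M (L N M))
        - z ^ 2 * Phi N M (L N M) * Phi M M (K N M)) ∧
    (G N M = 1 + z * (qPow 1 + qPow (-1)) * G N M
        + z ^ 2 * G N M * (Phi N M (L N M) + Phi M N (K N M))) := by
  refine ⟨genFun_avoiding true, ?_, genFun_wordsH⟩
  rw [add_comm (Phi M N (K N M))]
  exact genFun_avoiding false
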